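/- Let $X$ be a non-empty set, $S,B\subseteq\{-1,1,*\}^X$ classes of partial binary hypotheses, where $*$ is the undefined label, and $n\ge 1$ an integer. A (possibly inefficient and randomized) online learner $L$ is run on a fixed stream $(x_1,y_1),\dots,(x_n,y_n)\in X\times\{-1,1\}$: in round $i$ it is given $(x_1,y_1),\dots,(x_{i-1},y_{i-1})$ and $x_i$, and outputs a (random) prediction $\hat y_i\in\{-1,1\}$. Put $\mathrm{mistake}(L;(x_i,y_i)_{i=1}^n)=\frac1n\sum_{i=1}^n\Pr[\hat y_i\neq y_i]$, the probability being over the internal randomness of $L$, and for $h:X\to\{-1,1,*\}$ put $\mathrm{mistake}(h;(x_i,y_i)_{i=1}^n)=\frac1n\sum_{i=1}^n\mathbf 1(h(x_i)\ne y_i)$. For $\varepsilon\ge 0$ let $\mathrm{CompOL}_n(S,B,\varepsilon)$ be the set of all online learners $L$ such that, for every $s\in S$ and every stream with $y_i=s(x_i)$ for all $i=1,\dots,n$, \[ \mathrm{mistake}(L;(x_i,y_i)_{i=1}^n)\le\inf_{b\in B}\mathrm{mistake}(b;(x_i,y_i)_{i=1}^n)+\varepsilon , \] where an infimum over the empty set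 is $+\infty$. Let $\varepsilon^*=\inf\{\varepsilon\ge 0:\mathrm{CompOL}_n(S,B,\varepsilon)\ne\emptyset\}$. A family $(x_\zeta)$ of points of $X$, indexed by the strings $\zeta\in\bigcup_{i=0}^{m-1}\{-1,1\}^i$, is shattered by a class $H\subseteq\{-1,1,*\}^X$ if for every $\xi\in\{-1,1\}^m$ there is $h\in H$ with $h(x_{(\xi_1,\dots,\xi_{i-1})})=\xi_i$ for all $i=1,\dots,m$. Let $m=\mathrm{Ldim}(S,B)\in\{0,1,2,\dots\}\cup\{\infty\}$ be the mutual Littlestone dimension, i.e. the supremum of all integers $m\ge0$ for which some such family is shattered by both $S$ and $B$ (the supremum of the empty set being $0$). Then there is a universal constant $C>0$, independent of $X,S,B$ and $n$, such that \[ \min\Big\{\frac12,\frac{m}{2n}\Big\}\le\varepsilon^*\le C\sqrt{\frac mn\,\log\frac{2m+n}{m}} . \] Here, for $m=\infty$, the left-hand side is $\frac12$ and the right-hand side is $+\infty$; for $m=0$, both sides are $0$. -/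

import Mathlib

open MeasureTheory
open scoped ENNReal

universe u

namespace ComparativeOnline

/-- The set of labels `{-1, 1}`. -/
abbrev Label : Type := ℤˣ

/-- Partial binary hypotheses `h : X → {-1, 1, *}`; `none` is the undefined label `*`. -/
abbrev Hypothesis (X : Type u) : Type u := X → Option Label

/-- A (randomized) online learner. Its internal randomness is a seed drawn from a probability
space; given the seed, the list of labeled data points seen so far and the current unlabeled
point, it outputs a prediction. -/
structure OnlineLearner (X : Type u) where
  Seed : Type
  mSeed : MeasurableSpace Seed
  seedLaw : @Measure Seed mSeed
  isProb : @IsProbabilityMeasure Seed mSeed seedLaw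
  predict : Seed → List (X × Label) → X → Label
  measurable_predict : ∀ (past : List (X × Label)) (x : X) (y : Label),
    @MeasurableSet Seed mSeed {ω | predict ω past x = y}

/-- The probability, over the internal randomness of the learner, that its prediction on the point
`x` after having seen the labeled points `past` differs from `y`. -/
noncomputable def OnlineLearner.errProb {X : Type u} (L : OnlineLearner X)
    (past : List (X × Label)) (x : X) (y : Label) : ℝ :=
  letI := L.mSeed
  L.seedLaw.real {ω | L.predict ω past x ≠ y}

/-- Expected fraction of mistakes of the learner on a stream of `n` labeled data points. In round
`i` (counted from `0`) the learner has seen the first `i` labeled points of the stream. -/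
noncomputable def OnlineLearner.mistake {X : Type u} {n : ℕ} (L : OnlineLearner X)
    (z : Fin n → X × Label) : ℝ :=
  (1 / (n : ℝ)) * ∑ i : Fin n, L.errProb ((List.ofFn z).take (i : ℕ)) (z i).1 (z i).2

open Classical in
/-- Fraction of mistakes of a hypothesis on a stream of `n` labeled data points; the undefined label
always counts as a mistake. -/
noncomputable def hypMistake {X : Type u} {n : ℕ} (h : Hypothesis X)
    (z : Fin n → X × Label) : ℝ :=
  (1 / (n : ℝ)) * ∑ i : Fin n, if h (z i).1 ≠ some (z i).2 then (1 : ℝ) else 0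

/-- The learners that solve comparative online learning for the source class `S` and the benchmark
class `B` over `n` rounds with regret bound `ε`. The infimum is taken in the extended reals, so that
the infimum over an empty benchmark class is `+∞`. -/
def CompOL {X : Type u} (n : ℕ) (S B : Set (Hypothesis X)) (ε : ℝ) : Set (OnlineLearner X) :=
  {L | ∀ s ∈ S, ∀ z : Fin n → X × Label, (∀ i, s (z i).1 = some (z i).2) →
    (L.mistake z : EReal) ≤ (⨅ b ∈ B, (hypMistake b z : EReal)) + (ε : EReal)}

/-- The optimal regret `ε*`: the infimum of all `ε ≥ 0` for which some learner solves the task. -/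
noncomputable def optimalRegret {X : Type u} (n : ℕ) (S B : Set (Hypothesis X)) : ℝ :=
  sInf {ε : ℝ | 0 ≤ ε ∧ (CompOL n S B ε).Nonempty}

/-- A complete binary tree of depth `m` with nodes labeled by points: `x i ζ` is the point at the
binary string `ζ` of length `i < m`. -/
abbrev PointTree (X : Type u) (m : ℕ) : Type u := (i : Fin m) → (Fin (i : ℕ) → Label) → X

/-- The tree is shattered by `H`: every branch `ξ` is realized by some hypothesis in `H`. -/
def Shatters {X : Type u} {m : ℕ} (H : Set (Hypothesis X)) (x : PointTree X m) : Prop :=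
  ∀ ξ : Fin m → Label, ∃ h ∈ H, ∀ i : Fin m,
    h (x i (fun j => ξ ⟨j, j.2.trans i.2⟩)) = some (ξ i)

/-- The mutual Littlestone dimension, with values in `ℕ ∪ {∞}`: the supremum of the depths of trees
shattered by both classes. -/
noncomputable def mutualLdim {X : Type u} (S B : Set (Hypothesis X)) : ℕ∞ :=
  ⨆ (m : ℕ) (_ : ∃ x : PointTree X m, Shatters S x ∧ Shatters B x), (m : ℕ∞)

theorem OnlineLearner.errProb_le_one {X : Type u} (L : OnlineLearner X)
    (past : List (X × Label)) (x : X) (y : Label) : L.errProb past x y ≤ 1 := by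
  letI := L.mSeed
  haveI := L.isProb
  exact measureReal_le_one

theorem OnlineLearner.mistake_le_one {X : Type u} {n : ℕ} (L : OnlineLearner X)
    (z : Fin n → X × Label) : L.mistake z ≤ 1 := by
  have h : ∑ i : Fin n, L.errProb ((List.ofFn z).take (i : ℕ)) (z i).1 (z i).2
      ≤ ∑ _i : Fin n, (1 : ℝ) := Finset.sum_le_sum fun i _ => L.errProb_le_one _ _ _
  simp only [Finset.sum_const, Finset.card_univ, Fintype.card_fin, nsmul_eq_mul, mul_one] at h
  unfold OnlineLearner.mistake
  rw [one_div_mul_eq_div]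
  exact div_le_one_of_le₀ h (Nat.cast_nonneg n)

theorem hypMistake_nonneg {X : Type u} {n : ℕ} (h : Hypothesis X)
    (z : Fin n → X × Label) : 0 ≤ hypMistake h z := by
  unfold hypMistake
  refine mul_nonneg (by positivity) (Finset.sum_nonneg fun i _ => ?_)
  split_ifs <;> norm_num

/-- The infimum in `optimalRegret` is a genuine one: the set is non-empty and bounded below. -/
theorem optimalRegret_isGLB {X : Type u} (n : ℕ) (S B : Set (Hypothesis X)) :
    IsGLB {ε : ℝ | 0 ≤ ε ∧ (CompOL n S B ε).Nonempty} (optimalRegret n S B) := by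
  refine isGLB_csInf ⟨1, zero_le_one, ⟨⟨Unit, ⊤, @Measure.dirac Unit ⊤ (),
    @Measure.dirac.isProbabilityMeasure Unit ⊤ (), fun _ _ _ => 1, fun _ _ _ => trivial⟩, ?_⟩⟩
    ⟨0, fun ε h => h.1⟩
  intro s _ z _
  have h0 : (0 : EReal) ≤ ⨅ b ∈ B, (hypMistake b z : EReal) :=
    le_iInf₂ fun b _ => by exact_mod_cast hypMistake_nonneg b z
  calc _ ≤ ((1 : ℝ) : EReal) := by exact_mod_cast OnlineLearner.mistake_le_one _ z
    _ = 0 + ((1 : ℝ) : EReal) := (zero_add _).symm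
    _ ≤ _ := by gcongr

end ComparativeOnline

namespace ComparativeOnline

open Finset

/-! ### Learners from prediction probabilities -/

-- Lower bound: an adversary walks down a mutually shattered tree and gives each point a label on
-- which the learner errs with probability at least 1/2 (`exists_hard_branch`). The branch is
-- realized by some s in S, so it is a legal stream, and by some b in B, so the benchmark is 0 and
-- every forced mistake counts as regret (`le_optimalRegret`).
--
-- Upper bound: suppose no tree of depth m + 1 is mutually shattered. Run the standard optimal
-- algorithm on the pair of version spaces, updating only in rounds where it errs and b is correct.
-- Then s and b stay in the version spaces and each update lowers the depth bound by one
-- (`SOAState.Valid.update`), so at most m updates occur. The learner does not know b, hence not the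
-- update rounds, so every set I of at most m rounds gets an expert that guesses them; for the right
-- I it errs only where b does (`SOAState.exists_expert`). Exponential weights over these experts
-- (`exists_learner_expWeights`), with the count from `log_card_roundSets_le`, give the regret.

theorem OnlineLearner.errProb_nonneg {X : Type u} (L : OnlineLearner X)
    (past : List (X × Label)) (x : X) (y : Label) : 0 ≤ L.errProb past x y := by
  let := L.mSeed
  exact measureReal_nonneg

theorem OnlineLearner.one_le_errProb_add {X : Type u} (L : OnlineLearner X)
    (past : List (X × Label)) (x : X) :
    1 ≤ L.errProb past x 1 + L.errProb past x (-1) := by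
  let := L.mSeed
  have := L.isProb
  have h : ({ω | L.predict ω past x ≠ 1} ∪ {ω | L.predict ω past x ≠ -1}) = Set.univ := by
    ext ω
    rcases Int.units_eq_one_or (L.predict ω past x) with h | h <;> simp [h]
  have := measureReal_union_le (μ := L.seedLaw) {ω | L.predict ω past x ≠ 1}
    {ω | L.predict ω past x ≠ -1}
  rw [h, probReal_univ] at this
  exact this

theorem OnlineLearner.exists_half_le_errProb {X : Type u} (L : OnlineLearner X)
    (past : List (X × Label)) (x : X) : ∃ y, 1 / 2 ≤ L.errProb past x y := by
  by_contra! h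
  linarith [h 1, h (-1), L.one_le_errProb_add past x]

/-- Every assignment of prediction probabilities is realized by a randomized learner. -/
theorem exists_learner_of_prob {X : Type u} (q : List (X × Label) → X → ℝ)
    (h0 : ∀ past x, 0 ≤ q past x) (h1 : ∀ past x, q past x ≤ 1) :
    ∃ L : OnlineLearner X, ∀ past x,
      L.errProb past x 1 = 1 - q past x ∧ L.errProb past x (-1) = q past x := by
  classical
  have hne : (-1 : Label) ≠ 1 := by decide
  refine ⟨⟨ℝ, inferInstance, volume.restrict (Set.Ioc 0 1), ⟨by simp⟩,
    fun ω past x => if ω ≤ q past x then 1 else -1, ?_⟩, fun past x => ⟨?_, ?_⟩⟩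
  · intro past x y
    let _ : MeasurableSpace Label := ⊤
    have h : Measurable fun ω : ℝ => if ω ≤ q past x then (1 : Label) else -1 :=
      Measurable.ite measurableSet_Iic measurable_const measurable_const
    exact h (MeasurableSpace.measurableSet_top (s := {y}))
  · have : {ω : ℝ | (if ω ≤ q past x then (1 : Label) else -1) ≠ 1} = Set.Ioi (q past x) := by
      ext ω
      by_cases h : ω ≤ q past x <;> simp [h, hne, not_lt.mpr, not_le.mp]
    simp only [OnlineLearner.errProb]
    rw [this, measureReal_restrict_apply measurableSet_Ioi,
      show Set.Ioi (q past x) ∩ Set.Ioc 0 1 = Set.Ioc (q past x) 1 by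
        ext ω
        simp only [Set.mem_inter_iff, Set.mem_Ioi, Set.mem_Ioc]
        exact ⟨fun h => ⟨h.1, h.2.2⟩, fun h => ⟨h.1, (h0 past x).trans_lt h.1, h.2⟩⟩]
    simp [measureReal_def, h1 past x]
  · have : {ω : ℝ | (if ω ≤ q past x then (1 : Label) else -1) ≠ -1} = Set.Iic (q past x) := by
      ext ω
      by_cases h : ω ≤ q past x <;> simp [h, hne.symm]
    simp only [OnlineLearner.errProb]
    rw [this, measureReal_restrict_apply measurableSet_Iic,
      show Set.Iic (q past x) ∩ Set.Ioc 0 1 = Set.Ioc 0 (q past x) by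
        ext ω
        simp only [Set.mem_inter_iff, Set.mem_Iic, Set.mem_Ioc]
        exact ⟨fun h => ⟨h.2.1, h.1⟩, fun h => ⟨h.2, h.1, h.2.trans (h1 past x)⟩⟩]
    simp [measureReal_def, h0 past x]

/-! ### Streams as sequences -/

/-- The first `t` terms of a sequence, as a list. -/
abbrev prefixList {α : Type*} (w : ℕ → α) (t : ℕ) : List α := (List.range t).map w

/-- Padding with a term of the stream itself keeps the whole sequence consistent with any hypothesis
that realizes the stream. -/
theorem exists_seq_extension {α : Type*} {n : ℕ} (hn : 0 < n) (z : Fin n → α) :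
    ∃ w : ℕ → α, (∀ i : Fin n, w i = z i) ∧ (∀ i, ∃ j, w i = z j) ∧
      ∀ i : Fin n, (List.ofFn z).take i = prefixList w i := by
  refine ⟨fun i => if h : i < n then z ⟨i, h⟩ else z ⟨0, hn⟩, fun i => by simp, fun i => ?_,
    fun i => ?_⟩
  · by_cases h : i < n
    · exact ⟨⟨i, h⟩, by simp [h]⟩
    · exact ⟨⟨0, hn⟩, by simp [h]⟩
  · apply List.ext_getElem
    · simp [i.2.le]
    · intro j h₁ h₂
      have hj : j < n := by simp at h₁; omega
      simp [hj]

/-! ### Exponential weights -/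

/-- Whether a deterministic strategy errs, as a number. -/
noncomputable def errInd {X : Type u} (f : X → Label) (z : X × Label) : ℝ := if f z.1 ≠ z.2 then 1 else 0

/-- The number of mistakes of a deterministic strategy on a list. -/
noncomputable def cumLoss {X : Type u} (f : List (X × Label) → X → Label)
    (past : List (X × Label)) : ℝ :=
  ∑ i ∈ range past.length, (past[i]?).elim 0 fun z => errInd (f (past.take i)) z

theorem cumLoss_prefixList {X : Type u} (f : List (X × Label) → X → Label)
    (w : ℕ → X × Label) (t : ℕ) :
    cumLoss f (prefixList w t) = ∑ i ∈ range t, errInd (f (prefixList w i)) (w i) := by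
  unfold cumLoss
  simp only [prefixList, List.length_map, List.length_range]
  refine sum_congr rfl fun i hi => ?_
  have hi : i < t := mem_range.mp hi
  rw [← List.map_take, List.take_range, min_eq_left hi.le]
  simp [hi]

/-- The exponential weights forecaster. -/
theorem exists_learner_expWeights {X : Type u} {E : Type*} [Fintype E] [Nonempty E]
    (f : E → List (X × Label) → X → Label) {η : ℝ} (hη : 0 < η) :
    ∃ L : OnlineLearner X, ∀ (w : ℕ → X × Label) (n : ℕ) (e : E),
      ∑ i ∈ range n, L.errProb (prefixList w i) (w i).1 (w i).2 ≤
        (1 + η) * (Real.log (Fintype.card E) / η +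
          ∑ i ∈ range n, errInd (f e (prefixList w i)) (w i)) := by
  classical
  set W : E → List (X × Label) → ℝ := fun e past => Real.exp (-η * cumLoss (f e) past) with hW
  have hWpos : ∀ e past, 0 < W e past := fun e past => Real.exp_pos _
  set Φ : List (X × Label) → ℝ := fun past => ∑ e, W e past with hΦ
  have hΦpos : ∀ past, 0 < Φ past := fun past =>
    sum_pos (fun e _ => hWpos e past) univ_nonempty
  set P : List (X × Label) → X → Label → ℝ :=
    fun past x y => (∑ e, W e past * errInd (f e past) (x, y)) / Φ past with hP
  have hind0 : ∀ (g : X → Label) z, 0 ≤ errInd g z := fun g z => by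
    unfold errInd; split_ifs <;> norm_num
  have hP0 : ∀ past x y, 0 ≤ P past x y := fun past x y =>
    div_nonneg (sum_nonneg fun e _ => mul_nonneg (hWpos e past).le (hind0 _ _)) (hΦpos past).le
  have hPadd : ∀ past x, P past x 1 + P past x (-1) = 1 := fun past x => by
    rw [hP]
    simp only
    rw [← add_div, ← sum_add_distrib, div_eq_one_iff_eq (hΦpos past).ne']
    refine sum_congr rfl fun e _ => ?_
    rw [← mul_add]
    have hne : (-1 : Label) ≠ 1 := by decide
    rcases Int.units_eq_one_or (f e past x) with h | h <;> simp [errInd, h, hne, hne.symm]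
  obtain ⟨L, hL⟩ := exists_learner_of_prob (fun past x => P past x (-1)) (fun past x => hP0 _ _ _)
    (fun past x => by linarith [hPadd past x, hP0 past x 1])
  have hLP : ∀ past x y, L.errProb past x y = P past x y := fun past x y => by
    rcases Int.units_eq_one_or y with rfl | rfl
    · rw [(hL past x).1]; linarith [hPadd past x]
    · exact (hL past x).2
  refine ⟨L, fun w n e => ?_⟩
  set c : ℝ := 1 - Real.exp (-η) with hc
  have hstep : ∀ t, Φ (prefixList w (t + 1)) ≤
      Φ (prefixList w t) * Real.exp (-c * L.errProb (prefixList w t) (w t).1 (w t).2) := by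
    intro t
    -- The loss is 0 or 1, so exp(-η · loss) equals 1 - c · loss exactly.
    have h1 : ∀ e, W e (prefixList w (t + 1)) =
        W e (prefixList w t) - c * (W e (prefixList w t) *
          errInd (f e (prefixList w t)) (w t)) := fun e => by
      simp only [hW, cumLoss_prefixList]
      rw [sum_range_succ, mul_add, Real.exp_add]
      unfold errInd
      split_ifs
      · simp only [hc]; ring_nf
      · simp
    have h2 : Φ (prefixList w (t + 1)) = Φ (prefixList w t) *
        (1 - c * L.errProb (prefixList w t) (w t).1 (w t).2) := by
      rw [hLP]
      simp only [hΦ, hP] at *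
      rw [sum_congr rfl fun e _ => h1 e, sum_sub_distrib, ← mul_sum]
      field_simp [(hΦpos (prefixList w t)).ne']
    rw [h2]
    refine mul_le_mul_of_nonneg_left ?_ (hΦpos _).le
    linarith [Real.add_one_le_exp (-c * L.errProb (prefixList w t) (w t).1 (w t).2)]
  have hall : ∀ t, Φ (prefixList w t) ≤ Fintype.card E *
      Real.exp (-c * ∑ i ∈ range t, L.errProb (prefixList w i) (w i).1 (w i).2) := by
    intro t
    induction t with
    | zero => simp [hΦ, hW, cumLoss]
    | succ t ih =>
      refine (hstep t).trans ?_
      rw [sum_range_succ, mul_add, Real.exp_add, ← mul_assoc]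
      exact mul_le_mul_of_nonneg_right ih (Real.exp_pos _).le
  set ℓ := ∑ i ∈ range n, errInd (f e (prefixList w i)) (w i) with hℓ
  set R := ∑ i ∈ range n, L.errProb (prefixList w i) (w i).1 (w i).2 with hR
  have hN : (0 : ℝ) < Fintype.card E := by exact_mod_cast Fintype.card_pos
  have hlow : Real.exp (-η * ℓ) ≤ Fintype.card E * Real.exp (-c * R) := by
    refine le_trans ?_ (hall n)
    rw [hℓ, ← cumLoss_prefixList]
    exact single_le_sum (f := fun e => W e (prefixList w n)) (fun e _ => (hWpos e _).le)
      (mem_univ e)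
  have hlog : c * R ≤ Real.log (Fintype.card E) + η * ℓ := by
    have := Real.log_le_log (Real.exp_pos _) hlow
    rw [Real.log_exp, Real.log_mul hN.ne' (Real.exp_pos _).ne', Real.log_exp] at this
    linarith
  -- This trades the factor η / c for 1 + η; it is exp η ≥ 1 + η multiplied by exp(-η).
  have hcη : η ≤ (1 + η) * c := by
    have h1 : 1 + η ≤ Real.exp η := by linarith [Real.add_one_le_exp η]
    have h2 : Real.exp η * Real.exp (-η) = 1 := by rw [← Real.exp_add]; simp
    have h3 := mul_le_mul_of_nonneg_right h1 (Real.exp_pos (-η)).le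
    rw [hc]; linarith
  have hR0 : 0 ≤ R := sum_nonneg fun i _ => L.errProb_nonneg _ _ _
  have : η * R ≤ η * ((1 + η) * (Real.log (Fintype.card E) / η + ℓ)) := by
    calc η * R ≤ (1 + η) * c * R := mul_le_mul_of_nonneg_right hcη hR0
      _ = (1 + η) * (c * R) := by ring
      _ ≤ (1 + η) * (Real.log (Fintype.card E) + η * ℓ) :=
        mul_le_mul_of_nonneg_left hlog (by linarith)
      _ = _ := by field_simp
  exact le_of_mul_le_mul_left this hη

/-! ### Mutually shattered trees and version spaces -/

/-- Some tree of depth `d` is shattered by both classes. -/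
def MutuallyShatter {X : Type u} (S B : Set (Hypothesis X)) (d : ℕ) : Prop :=
  ∃ x : PointTree X d, Shatters S x ∧ Shatters B x

/-- The hypotheses in the class that give `x` the label `y`. -/
def versionSpace {X : Type u} (H : Set (Hypothesis X)) (z : X × Label) : Set (Hypothesis X) :=
  {h ∈ H | h z.1 = some z.2}

/-- The tree with root `x` and subtrees `T y`. -/
def graft {X : Type u} {d : ℕ} (x : X) (T : Label → PointTree X d) : PointTree X (d + 1) :=
  Fin.cases (fun _ => x) fun i ζ => T (ζ ⟨0, by simp⟩) i fun j => ζ ⟨j + 1, by simp⟩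

theorem Shatters.graft {X : Type u} {d : ℕ} {H : Set (Hypothesis X)} {x : X}
    {T : Label → PointTree X d} (h : ∀ y, Shatters (versionSpace H (x, y)) (T y)) :
    Shatters H (graft x T) := by
  intro ξ
  obtain ⟨g, hg, hgT⟩ := h (ξ 0) (fun i => ξ i.succ)
  refine ⟨g, hg.1, fun i => ?_⟩
  cases i using Fin.cases with
  | zero => exact hg.2
  | succ i => exact hgT i

/-- For each label one subtree serves both restricted classes, so a single graft is shattered by
both S and B. -/
theorem MutuallyShatter.succ {X : Type u} {d : ℕ} {S B : Set (Hypothesis X)} {x : X}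
    (h : ∀ y, MutuallyShatter (versionSpace S (x, y)) (versionSpace B (x, y)) d) :
    MutuallyShatter S B (d + 1) := by
  choose T hS hB using h
  exact ⟨graft x T, Shatters.graft hS, Shatters.graft hB⟩

theorem mutuallyShatter_zero {X : Type u} {S B : Set (Hypothesis X)} {s b : Hypothesis X}
    (hs : s ∈ S) (hb : b ∈ B) : MutuallyShatter S B 0 :=
  ⟨fun i => i.elim0, fun _ => ⟨s, hs, fun i => i.elim0⟩, fun _ => ⟨b, hb, fun i => i.elim0⟩⟩

theorem MutuallyShatter.le_mutualLdim {X : Type u} {d : ℕ} {S B : Set (Hypothesis X)}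
    (h : MutuallyShatter S B d) : (d : ℕ∞) ≤ mutualLdim S B :=
  le_iSup₂ (f := fun (m : ℕ) (_ : MutuallyShatter S B m) => (m : ℕ∞)) d h

/-! ### The standard optimal algorithm on pairs of classes, and its experts -/

/-- A pair of version spaces, with the number `fuel` for which no tree of depth `fuel` is
mutually shattered. -/
structure SOAState (X : Type u) where
  source : Set (Hypothesis X)
  bench : Set (Hypothesis X)
  fuel : ℕ

namespace SOAState

variable {X : Type u}

open Classical in
/-- The prediction of the standard optimal algorithm. -/
noncomputable def predict (σ : SOAState X) (x : X) : Label :=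
  if MutuallyShatter (versionSpace σ.source (x, 1)) (versionSpace σ.bench (x, 1)) (σ.fuel - 1)
  then 1 else -1

/-- The state after a labeled point has been taken into account. -/
def update (σ : SOAState X) (z : X × Label) : SOAState X :=
  ⟨versionSpace σ.source z, versionSpace σ.bench z, σ.fuel - 1⟩

/-- The state is compatible with the pair `s`, `b`. -/
structure Valid (σ : SOAState X) (s b : Hypothesis X) : Prop where
  source_mem : s ∈ σ.source
  bench_mem : b ∈ σ.bench
  not_shatter : ¬ MutuallyShatter σ.source σ.bench σ.fuel

/-- At fuel 0 the empty tree would be shattered by the two nonempty version spaces. Hence updates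
stop before the fuel runs out. -/
theorem Valid.fuel_pos {σ : SOAState X} {s b : Hypothesis X} (h : σ.Valid s b) : 0 < σ.fuel := by
  rcases Nat.eq_zero_or_pos σ.fuel with h0 | h0
  · exact absurd (h0 ▸ mutuallyShatter_zero h.source_mem h.bench_mem) h.not_shatter
  · exact h0

/-- An error on label y means that the restriction to y shatters no tree of depth `fuel - 1`: for y
= 1 this is the failed test in `predict`; for y = -1 the test succeeded for 1, and success for both
labels would graft to a tree of depth `fuel`. -/
theorem Valid.update {σ : SOAState X} {s b : Hypothesis X} (h : σ.Valid s b) {z : X × Label}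
    (hs : s z.1 = some z.2) (hb : b z.1 = some z.2) (hz : σ.predict z.1 ≠ z.2) :
    (σ.update z).Valid s b := by
  refine ⟨⟨h.source_mem, hs⟩, ⟨h.bench_mem, hb⟩, fun hsh => ?_⟩
  obtain ⟨x, y⟩ := z
  simp only [SOAState.update] at hsh
  unfold predict at hz
  split_ifs at hz with h1
  · have hy : y = -1 := (Int.units_eq_one_or y).resolve_left (Ne.symm hz)
    subst hy
    refine h.not_shatter ?_
    rw [← Nat.sub_add_cancel h.fuel_pos]
    refine MutuallyShatter.succ (x := x) fun y => ?_
    rcases Int.units_eq_one_or y with rfl | rfl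
    · exact h1
    · exact hsh
  · have hy : y = 1 := (Int.units_eq_one_or y).resolve_right (Ne.symm hz)
    subst hy
    exact h1 hsh

/-- The state, together with the number of rounds, after one round of the expert that updates in
the rounds in `I` only. -/
def expertStep (I : Finset ℕ) (τ : ℕ × SOAState X) (z : X × Label) : ℕ × SOAState X :=
  (τ.1 + 1, if τ.1 ∈ I then τ.2.update z else τ.2)

/-- The prediction of the expert that expects the standard optimal algorithm to err exactly in the
rounds in `I`. -/
noncomputable def expert (σ : SOAState X) (I : Finset ℕ) (past : List (X × Label)) (x : X) :
    Label :=
  let τ := past.foldl (expertStep I) (0, σ)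
  if τ.1 ∈ I then -τ.2.predict x else τ.2.predict x

open Classical in
/-- The states of the algorithm that updates when it errs while `b` does not. -/
noncomputable def run (σ : SOAState X) (b : Hypothesis X) (w : ℕ → X × Label) : ℕ → SOAState X
  | 0 => σ
  | t + 1 =>
    if (run σ b w t).predict (w t).1 ≠ (w t).2 ∧ b (w t).1 = some (w t).2 then
      (run σ b w t).update (w t)
    else run σ b w t

/-- Some expert errs only when `b` errs. -/
theorem exists_expert {σ : SOAState X} {s b : Hypothesis X} (hσ : σ.Valid s b)
    {w : ℕ → X × Label} (hw : ∀ i, s (w i).1 = some (w i).2) (n : ℕ) :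
    ∃ I ⊆ range n, #I < σ.fuel ∧ ∀ i < n, b (w i).1 = some (w i).2 →
      σ.expert I (prefixList w i) (w i).1 = (w i).2 := by
  classical
  set p : ℕ → Prop := fun t =>
    (run σ b w t).predict (w t).1 ≠ (w t).2 ∧ b (w t).1 = some (w t).2 with hp
  have hrun : ∀ t, run σ b w (t + 1) =
      if p t then (run σ b w t).update (w t) else run σ b w t := fun t => rfl
  -- Updates made plus fuel left is constant; positive fuel then bounds the updates strictly.
  have hvalid : ∀ t, (run σ b w t).Valid s b ∧
      #((range t).filter p) + (run σ b w t).fuel = σ.fuel := by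
    intro t
    induction t with
    | zero => exact ⟨hσ, by simp [run]⟩
    | succ t ih =>
      rw [hrun, range_add_one, filter_insert]
      split_ifs with h
      · refine ⟨ih.1.update (hw t) h.2 h.1, ?_⟩
        rw [card_insert_of_notMem (by simp)]
        have := ih.1.fuel_pos
        simp only [SOAState.update]
        omega
      · exact ih
  refine ⟨(range n).filter p, filter_subset _ _, ?_, fun i hi hb => ?_⟩
  · have := (hvalid n).1.fuel_pos
    have := (hvalid n).2
    omega
  · have hfold : ∀ t ≤ n, (prefixList w t).foldl (expertStep ((range n).filter p)) (0, σ) =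
        (t, run σ b w t) := by
      intro t ht
      induction t with
      | zero => rfl
      | succ t ih =>
        rw [prefixList, List.range_succ, List.map_append, List.foldl_append, ih (by omega)]
        have : t < n := by omega
        simp [expertStep, hrun, this]
    unfold expert
    rw [hfold i hi.le]
    -- Where b is correct, the rounds in I are exactly the errors of the algorithm, and flipping its
    -- prediction there gives the true label.
    have hmem : i ∈ (range n).filter p ↔ (run σ b w i).predict (w i).1 ≠ (w i).2 := by
      simp [hi, hp, hb]
    simp only [hmem]
    split_ifs with h
    · exact neg_eq_iff_eq_neg.mpr (Int.units_ne_iff_eq_neg.mp h)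
    · exact not_not.mp h

end SOAState

/-! ### The upper bound -/

/-- The sets of at most `m` rounds among `n`. -/
def roundSets (n m : ℕ) : Finset (Finset ℕ) := (range n).powerset.filter fun I => #I ≤ m

theorem empty_mem_roundSets (n m : ℕ) : ∅ ∈ roundSets n m := by simp [roundSets]

theorem roundSets_zero (n : ℕ) : roundSets n 0 = {∅} := by
  ext I
  simp only [roundSets, mem_filter, mem_powerset, Nat.le_zero, card_eq_zero, mem_singleton]
  exact ⟨fun h => h.2, fun h => ⟨by simp [h], h⟩⟩

/-- Weight each I by q^#I with q = m / n ≤ 1: every counted set weighs at least q^m, while all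
subsets together weigh (1 + q)^n ≤ exp m. -/
theorem log_card_roundSets_le {n m : ℕ} (hm : 0 < m) (hmn : m ≤ n) :
    Real.log #(roundSets n m) ≤ m + m * Real.log (n / m) := by
  have hm' : (0 : ℝ) < m := by exact_mod_cast hm
  have hn' : (0 : ℝ) < n := by exact_mod_cast hm.trans_le hmn
  have hq0 : (0 : ℝ) < m / n := by positivity
  have hq1 : (m / n : ℝ) ≤ 1 := div_le_one_of_le₀ (by exact_mod_cast hmn) hn'.le
  have hN : (0 : ℝ) < #(roundSets n m) := by
    exact_mod_cast card_pos.mpr ⟨_, empty_mem_roundSets n m⟩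
  have h1 : (#(roundSets n m) : ℝ) * (m / n) ^ m ≤ Real.exp m := by
    calc (#(roundSets n m) : ℝ) * (m / n) ^ m
        = ∑ _I ∈ roundSets n m, (m / n : ℝ) ^ m := by simp
      _ ≤ ∑ I ∈ roundSets n m, (m / n : ℝ) ^ #I := sum_le_sum fun I hI =>
          pow_le_pow_of_le_one hq0.le hq1 (mem_filter.mp hI).2
      _ ≤ ∑ I ∈ (range n).powerset, (m / n : ℝ) ^ #I :=
          sum_le_sum_of_subset_of_nonneg (filter_subset _ _) fun _ _ _ => by positivity
      _ = (m / n + 1 : ℝ) ^ n := by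
          have := sum_pow_mul_eq_add_pow (m / n : ℝ) 1 (range n)
          simpa using this
      _ ≤ Real.exp (m / n) ^ n := pow_le_pow_left₀ (by positivity) (Real.add_one_le_exp _) n
      _ = Real.exp m := by rw [← Real.exp_nat_mul]; congr 1; field_simp
  have h2 := Real.log_le_log (by positivity) h1
  rw [Real.log_mul hN.ne' (by positivity), Real.log_pow, Real.log_exp,
    ← inv_div, Real.log_inv] at h2
  linarith

theorem optimalRegret_le_one {X : Type u} (n : ℕ) (S B : Set (Hypothesis X)) :
    optimalRegret n S B ≤ 1 := by
  obtain ⟨L, -⟩ := exists_learner_of_prob (X := X) (fun _ _ => 0) (by simp) (by simp)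
  refine (optimalRegret_isGLB n S B).1 ⟨zero_le_one, L, fun s _ z _ => ?_⟩
  have h0 : (0 : EReal) ≤ ⨅ b ∈ B, (hypMistake b z : EReal) :=
    le_iInf₂ fun b _ => by exact_mod_cast hypMistake_nonneg b z
  calc _ ≤ ((1 : ℝ) : EReal) := by exact_mod_cast L.mistake_le_one z
    _ = 0 + ((1 : ℝ) : EReal) := (zero_add _).symm
    _ ≤ _ := by gcongr

/-- Moving the real ε to the other side leaves one inequality per b, with nothing to check when B is
empty. -/
theorem optimalRegret_le_of_forall {X : Type u} {n : ℕ} {S B : Set (Hypothesis X)} {ε : ℝ}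
    (hε : 0 ≤ ε) (L : OnlineLearner X)
    (h : ∀ s ∈ S, ∀ b ∈ B, ∀ z : Fin n → X × Label, (∀ i, s (z i).1 = some (z i).2) →
      L.mistake z ≤ hypMistake b z + ε) : optimalRegret n S B ≤ ε := by
  refine (optimalRegret_isGLB n S B).1 ⟨hε, L, fun s hs z hz => ?_⟩
  rw [← EReal.sub_le_iff_le_add (Or.inl (EReal.coe_ne_bot _)) (Or.inl (EReal.coe_ne_top _))]
  refine le_iInf₂ fun b hb => ?_
  rw [← EReal.coe_sub, EReal.coe_le_coe_iff]
  linarith [h s hs b hb z hz]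

/-- The expert from `exists_expert` makes at most M mistakes, M being the number made by b. The
factor 1 + η on M costs ηM ≤ ηn, which is the last term after division by n. -/
theorem optimalRegret_le_expWeights {X : Type u} {n m : ℕ} (hn : 0 < n)
    {S B : Set (Hypothesis X)} (hSB : ¬ MutuallyShatter S B (m + 1)) {η : ℝ} (hη : 0 < η) :
    optimalRegret n S B ≤
      Real.log #(roundSets n m) / n + Real.log #(roundSets n m) / n / η + η := by
  classical
  have : Nonempty (roundSets n m) := ⟨⟨∅, empty_mem_roundSets n m⟩⟩
  obtain ⟨L, hL⟩ := exists_learner_expWeights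
    (fun I : roundSets n m => SOAState.expert ⟨S, B, m + 1⟩ (I : Finset ℕ)) hη
  rw [Fintype.card_coe] at hL
  have hlog : 0 ≤ Real.log #(roundSets n m) := Real.log_natCast_nonneg _
  have hn' : (0 : ℝ) < n := by exact_mod_cast hn
  refine optimalRegret_le_of_forall (by positivity) L fun s hs b hb z hz => ?_
  obtain ⟨w, hwz, hw, hpre⟩ := exists_seq_extension hn z
  have hsw : ∀ i, s (w i).1 = some (w i).2 := fun i => by
    obtain ⟨j, hj⟩ := hw i
    rw [hj, hz]
  obtain ⟨I, hIn, hIc, hI⟩ := SOAState.exists_expert (σ := ⟨S, B, m + 1⟩) ⟨hs, hb, hSB⟩ hsw n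
  have hmem : I ∈ roundSets n m :=
    mem_filter.mpr ⟨mem_powerset.mpr hIn, Nat.lt_succ_iff.mp hIc⟩
  have hreg := hL w n ⟨I, hmem⟩
  have hmist : L.mistake z =
      1 / n * ∑ i ∈ range n, L.errProb (prefixList w i) (w i).1 (w i).2 := by
    rw [OnlineLearner.mistake, ← Fin.sum_univ_eq_sum_range
      (fun i => L.errProb (prefixList w i) (w i).1 (w i).2)]
    simp only [hpre, hwz]
  have hhyp : hypMistake b z =
      1 / n * ∑ i ∈ range n, if b (w i).1 ≠ some (w i).2 then (1 : ℝ) else 0 := by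
    rw [hypMistake, ← Fin.sum_univ_eq_sum_range
      (fun i => if b (w i).1 ≠ some (w i).2 then (1 : ℝ) else 0)]
    simp only [hwz]
  rw [hmist, hhyp]
  set R := ∑ i ∈ range n, L.errProb (prefixList w i) (w i).1 (w i).2
  set M := ∑ i ∈ range n, if b (w i).1 ≠ some (w i).2 then (1 : ℝ) else 0 with hM
  set ℓ := ∑ i ∈ range n, errInd (SOAState.expert ⟨S, B, m + 1⟩ I (prefixList w i)) (w i) with hℓ
  have hℓM : ℓ ≤ M := sum_le_sum fun i hi => by
    by_cases hbi : b (w i).1 = some (w i).2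
    · simp [errInd, hbi, hI i (mem_range.mp hi) hbi]
    · simp only [errInd, hbi, ne_eq, not_false_eq_true, if_true]
      split_ifs <;> norm_num
  have hMn : M ≤ n := by
    calc M ≤ ∑ _i ∈ range n, (1 : ℝ) := sum_le_sum fun i _ => by split_ifs <;> norm_num
      _ = n := by simp
  have hbound : R ≤ M + (Real.log #(roundSets n m) + Real.log #(roundSets n m) / η + η * n) := by
    calc R ≤ (1 + η) * (Real.log #(roundSets n m) / η + ℓ) := hreg
      _ ≤ (1 + η) * (Real.log #(roundSets n m) / η + M) := by gcongr
      _ = M + (Real.log #(roundSets n m) + Real.log #(roundSets n m) / η + η * M) := by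
          field_simp; ring
      _ ≤ _ := by gcongr
  calc 1 / n * R ≤ 1 / n * (M + (Real.log #(roundSets n m) +
        Real.log #(roundSets n m) / η + η * n)) := by gcongr
    _ = _ := by field_simp

theorem optimalRegret_le_sqrt {X : Type u} {n m : ℕ} (hn : 0 < n) {S B : Set (Hypothesis X)}
    (hSB : ¬ MutuallyShatter S B (m + 1)) :
    optimalRegret n S B ≤
      5 * Real.sqrt ((m : ℝ) / n * Real.log ((2 * (m : ℝ) + n) / m)) := by
  have hn' : (0 : ℝ) < n := by exact_mod_cast hn
  -- For m = 0 there is a single expert, so the regret is at most every η > 0; the right side is 0.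
  rcases Nat.eq_zero_or_pos m with rfl | hm
  · have h : ∀ η > 0, optimalRegret n S B ≤ 0 + η := fun η hη => by
      have := optimalRegret_le_expWeights hn hSB hη
      simpa [roundSets_zero] using this
    simpa using le_of_forall_pos_le_add h
  have hm' : (0 : ℝ) < m := by exact_mod_cast hm
  have hsplit : (2 * (m : ℝ) + n) / m = 2 + n / m := by field_simp
  rw [hsplit]
  set A : ℝ := (m : ℝ) / n * Real.log (2 + n / m) with hA
  have hq : (0 : ℝ) < n / m := by positivity
  have hlog2 : Real.log 2 ≤ Real.log (2 + n / m) := Real.log_le_log (by norm_num) (by linarith)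
  have hl2 := Real.log_two_gt_d9
  have hApos : 0 < A := mul_pos (by positivity) (by linarith)
  have hsq : Real.sqrt A ^ 2 = A := Real.sq_sqrt hApos.le
  have hspos : 0 < Real.sqrt A := Real.sqrt_pos.mpr hApos
  rcases le_or_gt (1 / 4) A with hbig | hsmall
  · have : 1 / 2 ≤ Real.sqrt A := Real.le_sqrt_of_sq_le (by norm_num; linarith)
    linarith [optimalRegret_le_one n S B]
  have hmn : m ≤ n := by
    by_contra! h
    have : (1 : ℝ) ≤ m / n := (one_le_div hn').mpr (by exact_mod_cast h.le)
    nlinarith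
  have h1q : (1 : ℝ) ≤ n / m := (one_le_div hm').mpr (by exact_mod_cast hmn)
  -- As n / m ≥ 1 and e < 3, the logarithm absorbs the additive 1 in the count of experts.
  have hone : 1 ≤ Real.log (2 + n / m) := by
    rw [Real.le_log_iff_exp_le (by linarith)]
    linarith [Real.exp_one_lt_d9]
  have hlogq : Real.log (n / m) ≤ Real.log (2 + n / m) := Real.log_le_log hq (by linarith)
  have hcard : Real.log #(roundSets n m) / n ≤ 2 * A := by
    calc Real.log #(roundSets n m) / n ≤ (m + m * Real.log (n / m)) / n := by
          gcongr; exact log_card_roundSets_le hm hmn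
      _ = m / n * (1 + Real.log (n / m)) := by ring
      _ ≤ m / n * (2 * Real.log (2 + n / m)) := by gcongr; linarith
      _ = 2 * A := by rw [hA]; ring
  have hle : Real.sqrt A ≤ 1 := by
    exact Real.sqrt_le_one.mpr (by linarith)
  -- The choice η = √A balances the terms, and A ≤ √A gives the constant 5 = 2 + 2 + 1.
  calc optimalRegret n S B
      ≤ Real.log #(roundSets n m) / n + Real.log #(roundSets n m) / n / Real.sqrt A +
          Real.sqrt A := optimalRegret_le_expWeights hn hSB hspos
    _ ≤ 2 * A + 2 * A / Real.sqrt A + Real.sqrt A := by gcongr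
    _ = 2 * Real.sqrt A ^ 2 + 2 * Real.sqrt A + Real.sqrt A := by
        rw [hsq, mul_div_assoc, Real.div_sqrt]
    _ ≤ 5 * Real.sqrt A := by nlinarith

/-! ### The lower bound -/

/-- The labeled points along the branch `ξ` of a tree of positive depth, repeating the last one. -/
def branch {X : Type u} {d : ℕ} (hd : 0 < d) (x : PointTree X d) (ξ : ℕ → Label) (i : ℕ) :
    X × Label :=
  (x ⟨min i (d - 1), by omega⟩ fun j => ξ j, ξ (min i (d - 1)))

theorem branch_congr {X : Type u} {d : ℕ} (hd : 0 < d) (x : PointTree X d) {ξ ξ' : ℕ → Label}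
    {i : ℕ} (h : ∀ j ≤ i, ξ j = ξ' j) : branch hd x ξ i = branch hd x ξ' i := by
  unfold branch
  refine Prod.ext ?_ (h _ (by omega))
  refine congrArg (x _) (funext fun j => h _ ?_)
  have := j.2
  simp only at this
  omega

/-- Repeating the last labeled point adds no constraint, so the branch stays realizable at every
length, also when n > d. -/
theorem Shatters.exists_branch {X : Type u} {d : ℕ} (hd : 0 < d) {x : PointTree X d}
    {H : Set (Hypothesis X)} (h : Shatters H x) (ξ : ℕ → Label) :
    ∃ g ∈ H, ∀ i, g (branch hd x ξ i).1 = some (branch hd x ξ i).2 := by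
  obtain ⟨g, hg, hgx⟩ := h fun i => ξ i
  exact ⟨g, hg, fun i => hgx ⟨min i (d - 1), by omega⟩⟩

/-- The k-th point depends only on the earlier labels, so label k can be chosen after the learner's
prediction probabilities are known, without disturbing earlier rounds. -/
theorem exists_hard_branch {X : Type u} {d : ℕ} (hd : 0 < d) (x : PointTree X d)
    (L : OnlineLearner X) (k : ℕ) (hk : k ≤ d) : ∃ ξ : ℕ → Label, ∀ i < k,
      1 / 2 ≤ L.errProb (prefixList (branch hd x ξ) i) (branch hd x ξ i).1
        (branch hd x ξ i).2 := by
  induction k with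
  | zero => exact ⟨fun _ => 1, fun i hi => absurd hi (Nat.not_lt_zero i)⟩
  | succ k ih =>
    obtain ⟨ξ, hξ⟩ := ih (by omega)
    obtain ⟨y, hy⟩ := L.exists_half_le_errProb (prefixList (branch hd x ξ) k) (branch hd x ξ k).1
    have hlt : ∀ i < k, branch hd x (Function.update ξ k y) i = branch hd x ξ i := fun i hi =>
      branch_congr hd x fun j hj => Function.update_of_ne (by omega) _ _
    have hpre : ∀ i ≤ k, prefixList (branch hd x (Function.update ξ k y)) i =
        prefixList (branch hd x ξ) i := fun i hi =>
      List.map_congr_left fun j hj => hlt j (by have := List.mem_range.mp hj; omega)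
    refine ⟨Function.update ξ k y, fun i hi => ?_⟩
    rw [hpre i (by omega)]
    rcases Nat.lt_succ_iff_lt_or_eq.mp hi with hi | rfl
    · rw [hlt i hi]; exact hξ i hi
    · have hmin : min i (d - 1) = i := by omega
      have h1 : (branch hd x (Function.update ξ i y) i).1 = (branch hd x ξ i).1 := by
        unfold branch
        refine congrArg (x _) (funext fun j => Function.update_of_ne ?_ _ _)
        have := j.2
        simp only at this
        omega
      have h2 : (branch hd x (Function.update ξ i y) i).2 = y := by
        simp [branch, hmin]
      rw [h1, h2]
      exact hy

theorem le_optimalRegret {X : Type u} {n d : ℕ} (hn : 0 < n) {S B : Set (Hypothesis X)}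
    (h : MutuallyShatter S B d) : (min d n : ℕ) / (2 * n : ℝ) ≤ optimalRegret n S B := by
  refine (optimalRegret_isGLB n S B).2 fun ε ⟨hε, L, hL⟩ => ?_
  have hn' : (0 : ℝ) < n := by exact_mod_cast hn
  rcases Nat.eq_zero_or_pos d with rfl | hd
  · simpa using hε
  obtain ⟨x, hS, hB⟩ := h
  obtain ⟨ξ, hξ⟩ := exists_hard_branch hd x L d le_rfl
  obtain ⟨s, hs, hsx⟩ := hS.exists_branch hd ξ
  obtain ⟨b, hb, hbx⟩ := hB.exists_branch hd ξ
  set w := branch hd x ξ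
  have hz := hL s hs (fun i : Fin n => w i) fun i => hsx i
  have hb0 : hypMistake b (fun i : Fin n => w i) = 0 := by simp [hypMistake, hbx]
  have hle : (L.mistake (fun i : Fin n => w i) : EReal) ≤ (ε : EReal) := by
    refine hz.trans ?_
    calc _ ≤ (hypMistake b (fun i : Fin n => w i) : EReal) + ε := by
          gcongr; exact iInf₂_le b hb
      _ = ε := by rw [hb0]; simp
  rw [EReal.coe_le_coe_iff] at hle
  refine le_trans ?_ hle
  have hmist : L.mistake (fun i : Fin n => w i) =
      1 / n * ∑ i ∈ range n, L.errProb (prefixList w i) (w i).1 (w i).2 := by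
    rw [OnlineLearner.mistake, ← Fin.sum_univ_eq_sum_range
      (fun i => L.errProb (prefixList w i) (w i).1 (w i).2)]
    congr 1
    refine sum_congr rfl fun i _ => ?_
    congr 1
    refine List.ext_getElem (by simp [i.2.le]) fun j h₁ h₂ => by simp
  have hsum : ((min d n : ℕ) : ℝ) * (1 / 2) ≤
      ∑ i ∈ range n, L.errProb (prefixList w i) (w i).1 (w i).2 := by
    calc ((min d n : ℕ) : ℝ) * (1 / 2) = ∑ _i ∈ range (min d n), (1 / 2 : ℝ) := by
          rw [sum_const, card_range, nsmul_eq_mul]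
      _ ≤ ∑ i ∈ range (min d n), L.errProb (prefixList w i) (w i).1 (w i).2 :=
          sum_le_sum fun i hi => hξ i (by have := mem_range.mp hi; omega)
      _ ≤ _ := sum_le_sum_of_subset_of_nonneg (range_mono (min_le_right _ _))
          fun i _ _ => L.errProb_nonneg _ _ _
  rw [hmist]
  calc ((min d n : ℕ) : ℝ) / (2 * n) = 1 / n * (((min d n : ℕ) : ℝ) * (1 / 2)) := by field_simp
    _ ≤ _ := by gcongr

theorem le_optimalRegret_of_le_mutualLdim {X : Type u} {n k : ℕ} (hn : 0 < n) (hk : k ≤ n)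
    {S B : Set (Hypothesis X)} (h : (k : ℕ∞) ≤ mutualLdim S B) :
    (k : ℝ) / (2 * n) ≤ optimalRegret n S B := by
  rcases k with _ | k
  · simpa using (optimalRegret_isGLB n S B).2 fun ε h => h.1
  -- Being strictly below the supremum yields a shattered tree of depth at least k + 1, even when
  -- the supremum is infinite.
  have hlt : (k : ℕ∞) < mutualLdim S B :=
    lt_of_lt_of_le (by exact_mod_cast Nat.lt_succ_self k) h
  unfold mutualLdim at hlt
  simp only [lt_iSup_iff] at hlt
  obtain ⟨d, hd, hkd⟩ := hlt
  have hkd : k + 1 ≤ min d n := le_min (by exact_mod_cast hkd) hk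
  refine le_trans ?_ (le_optimalRegret hn hd)
  gcongr

end ComparativeOnline

theorem mainTheorem4 :
    ∃ C : ℝ, 0 < C ∧
      ∀ (X : Type u) [Nonempty X] (S B : Set (ComparativeOnline.Hypothesis X)) (n : ℕ), 0 < n →
        (min (1 / 2 : ℝ≥0∞) ((ComparativeOnline.mutualLdim S B : ℝ≥0∞) / (2 * (n : ℝ≥0∞)))
          ≤ ENNReal.ofReal (ComparativeOnline.optimalRegret n S B)) ∧
        (∀ m : ℕ, ComparativeOnline.mutualLdim S B = (m : ℕ∞) →
          ComparativeOnline.optimalRegret n S B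
            ≤ C * Real.sqrt ((m : ℝ) / (n : ℝ) *
                Real.log ((2 * (m : ℝ) + (n : ℝ)) / (m : ℝ)))) := by
  refine ⟨5, by norm_num, fun X _ S B n hn => ⟨?_, fun m hm => ?_⟩⟩
  · have hn' : (0 : ℝ) < n := by exact_mod_cast hn
    -- The first case contains infinite dimension and gives n / (2n) = 1/2; in the second the
    -- dimension is a natural number below n.
    rcases le_or_gt (n : ℕ∞) (ComparativeOnline.mutualLdim S B) with h | h
    · refine (min_le_left _ _).trans ?_
      have := ComparativeOnline.le_optimalRegret_of_le_mutualLdim hn le_rfl h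
      rw [show (n : ℝ) / (2 * n) = 1 / 2 by field_simp] at this
      calc (1 / 2 : ℝ≥0∞) = ENNReal.ofReal (1 / 2) := by
            rw [ENNReal.ofReal_div_of_pos (by norm_num)]; simp
        _ ≤ _ := ENNReal.ofReal_le_ofReal this
    · refine (min_le_right _ _).trans ?_
      obtain ⟨k, hk⟩ := ENat.ne_top_iff_exists.mp h.ne_top
      rw [← hk] at h ⊢
      have := ComparativeOnline.le_optimalRegret_of_le_mutualLdim hn
        (by exact_mod_cast h.le) hk.le
      calc ((k : ℕ∞) : ℝ≥0∞) / (2 * (n : ℝ≥0∞)) = ENNReal.ofReal ((k : ℝ) / (2 * n)) := by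
            rw [ENNReal.ofReal_div_of_pos (by positivity), ENNReal.ofReal_mul (by norm_num)]
            simp
        _ ≤ _ := ENNReal.ofReal_le_ofReal this
  · refine ComparativeOnline.optimalRegret_le_sqrt hn fun h => ?_
    have := h.le_mutualLdim
    rw [hm] at this
    have : m + 1 ≤ m := by exact_mod_cast this
    omega
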